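/- All topological groups are Hausdorff. Let $G$ be a non-trivial compactly generated totally disconnected locally compact group, where compactly generated means that $G$ is generated by a compact subset. Assume that the centre of $G$ is trivial and that $G$ has no non-trivial discrete quotient, i.e. every normal subgroup $N$ of $G$ with $G/N$ discrete equals $G$. Denote by $\mathbf{Min}$ the set of all minimal elements, with respect to inclusion, of the set of closed normal subgroups $N\neq 1$ of $G$, and by $\mathbf{Max}$ the set of all maximal elements of the set of closed normal subgroups $N\neq G$ of $G$. Write $\mathscr{Z}_G(N)$ for the centraliser of $N$ in $G$. If $\bigcap_{K\in\mathbf{Max}} K$ is trivial (with the empty intersection understood as $G$), then the following hold. (i) $\mathbf{Min}$ and $\mathbf{Max}$ are finite and non-empty. (ii) The assignment $N \mapsto \mathscr{Z}_G(N)$ defines a bijection from $\mathbf{Min}$ to $\mathbf{Max}$. (iii) Every $N \in \mathbf{Min}\cup\mathbf{Max}$ is a quasi-factor of $G$, i.e. a closed normal subgroup such that $N\cdot\mathscr{Z}_G(N)$ is dense in $G$. (iv) $G$ is the quasi-product of its minimal non-trivial closed normal subgroups: if $N_1,\dots,N_p$ are the elements of $\mathbf{Min}$, listed without repetition in any order,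 then the multiplication map $N_1\times\cdots\times N_p \to G$, $(x_1,\dots,x_p)\mapsto x_1\cdots x_p$, is injective with dense image. -/

import Mathlib

open scoped Pointwise

/-- A topological group is compactly generated if some compact subset generates it
as an abstract group. -/
def IsCompactlyGeneratedGroup (G : Type*) [Group G] [TopologicalSpace G] : Prop :=
  ∃ S : Set G, IsCompact S ∧ Subgroup.closure S = ⊤

/-- `G` has no non-trivial discrete quotient: a normal subgroup whose quotient group is
discrete (in the quotient topology) is the whole group. -/
def NoNontrivialDiscreteQuotient (G : Type*) [Group G] [TopologicalSpace G] : Prop :=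
  ∀ N : Subgroup G, N.Normal → DiscreteTopology (G ⧸ N) → N = ⊤

/-- The set of minimal closed normal subgroups: the minimal elements, for inclusion, among the
closed normal subgroups different from `1` (the group `G` itself is allowed). -/
def minClosedNormal (G : Type*) [Group G] [TopologicalSpace G] : Set (Subgroup G) :=
  {N | Minimal (fun M : Subgroup G => M.Normal ∧ IsClosed (M : Set G) ∧ M ≠ ⊥) N}

/-- The set of maximal closed normal subgroups: the maximal elements, for inclusion, among the
closed normal subgroups different from `G` (the subgroup `1` is allowed). -/
def maxClosedNormal (G : Type*) [Group G] [TopologicalSpace G] : Set (Subgroup G) :=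
  {N | Maximal (fun M : Subgroup G => M.Normal ∧ IsClosed (M : Set G) ∧ M ≠ ⊤) N}

/-- A quasi-factor of `G` is a closed normal subgroup `N` such that `N · Z_G(N)` is dense. -/
structure IsQuasiFactor {G : Type*} [Group G] [TopologicalSpace G] (N : Subgroup G) : Prop where
  normal : N.Normal
  isClosed : IsClosed (N : Set G)
  dense : Dense ((N : Set G) * (Subgroup.centralizer (N : Set G) : Set G))

/-- The multiplication map `N₁ × ⋯ × N_p → G`, `(x₁, …, x_p) ↦ x₁ ⋯ x_p`. -/
def mulMap {G : Type*} [Group G] {p : ℕ} (N : Fin p → Subgroup G) (x : ∀ i, N i) : G :=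
  (List.ofFn fun i => (x i : G)).prod

/-- `G` is the quasi-product of the closed normal subgroups `N₁, …, N_p`: the multiplication
map is injective with dense image. -/
structure IsQuasiProduct {G : Type*} [Group G] [TopologicalSpace G] {p : ℕ}
    (N : Fin p → Subgroup G) : Prop where
  normal : ∀ i, (N i).Normal
  isClosed : ∀ i, IsClosed (N i : Set G)
  injective : Function.Injective (mulMap N)
  denseRange : DenseRange (mulMap N)

/-!
The quotients `G ⧸ K` by maximal closed normal subgroups `K` are topologically simple. As `G` has
no non-trivial discrete quotient, they are neither compact (a compact one would be profinite,
`NoNontrivialDiscreteQuotient.eq_top_of_cocompact`) nor abelian. Hence `K` is prime: a commutator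
`⁅A, B⁆` of normal subgroups lies in `K` only if `A` or `B` does
(`maxClosedNormal.le_or_le_of_commutator_le`). Moreover compact normal subgroups and discrete normal
subgroups of `G` map trivially to `G ⧸ K` (`maxClosedNormal.le_of_isCompact`,
`maxClosedNormal.le_of_inf_eq_bot`). Since the maximal closed normal subgroups intersect trivially,
`G` itself has no non-trivial compact or discrete normal subgroup.

The key compactness statement is `bot_mem_of_directedOn_of_sInf_eq_bot`: a filtering family of
closed normal subgroups with trivial intersection contains the trivial subgroup. Take a compact open
subgroup `U` and a compact generating set `S`. By compactness some member `N` of the family meets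
`U` only in elements that `S` conjugates into `U`. Then `N ⊓ U` is a compact normal subgroup, hence
trivial, so that `N` is discrete, hence trivial.

Applied to finite intersections of maximal subgroups, this and primeness show that there are
finitely many maximal subgroups. Applied to chains, it gives a minimal closed normal subgroup inside
each non-trivial closed normal one. If `M` is minimal and `K` is maximal with `¬ M ≤ K`, then
`M ⊓ K = ⊥`, so `K` centralises `M`, and `K` is the centraliser of `M` by maximality. By primeness
this matches minimal and maximal subgroups bijectively. The product `M * K` is dense by maximality
of `K`. The minimal subgroups other than `M` all lie in `K`, so the coordinate in `M` of a product
is determined modulo `K`. The product of the minimal subgroups is dense because a proper closed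
normal subgroup lies in a maximal one (`exists_le_maxClosedNormal`), and none contains all minimal
ones.
-/

open Topology

/-! ### Subgroups and products -/

section

variable {G : Type*} [Group G]

theorem Subgroup.normal_of_conj_mem_of_closure_eq_top {H : Subgroup G} {S : Set G}
    (hS : Subgroup.closure S = ⊤) (h : ∀ s ∈ S, ∀ x ∈ H, s * x * s⁻¹ ∈ H)
    (h' : ∀ s ∈ S, ∀ x ∈ H, s⁻¹ * x * s ∈ H) : H.Normal := by
  rw [← Subgroup.normalizer_eq_top_iff, eq_top_iff, ← hS, Subgroup.closure_le]
  refine fun s hs => Subgroup.mem_normalizer_iff.2 fun x => ⟨h s hs x, fun hx => ?_⟩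
  simpa [mul_assoc] using h' s hs _ hx

theorem Subgroup.normal_sInf {F : Set (Subgroup G)} (hF : ∀ N ∈ F, N.Normal) : (sInf F).Normal :=
  ⟨fun x hx g => Subgroup.mem_sInf.2 fun N hN =>
    (hF N hN).conj_mem x (Subgroup.mem_sInf.1 hx N hN) g⟩

theorem Subgroup.le_centralizer_of_inf_eq_bot {A B : Subgroup G} (hA : A.Normal) (hB : B.Normal)
    (h : A ⊓ B = ⊥) : A ≤ Subgroup.centralizer (B : Set G) := fun a ha =>
  Subgroup.mem_centralizer_iff.2 fun b hb =>
    (Subgroup.commute_of_normal_of_disjoint A B hA hB (disjoint_iff.2 h) a b ha hb).symm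

theorem List.prod_ofFn_eq_of_forall_ne {H : Type*} [Monoid H] {p : ℕ} (f : Fin p → H) (i : Fin p)
    (h : ∀ j, j ≠ i → f j = 1) : (List.ofFn f).prod = f i := by
  induction p with
  | zero => exact i.elim0
  | succ p ih =>
    rw [List.ofFn_succ, List.prod_cons]
    induction i using Fin.cases with
    | zero =>
      have : (fun j : Fin p => f j.succ) = fun _ => 1 := funext fun j => h _ (Fin.succ_ne_zero j)
      simp [this]
    | succ i =>
      rw [h 0 (Fin.succ_ne_zero i).symm, one_mul]
      exact ih (fun j => f j.succ) i fun j hj => h _ fun h' => hj (Fin.succ_injective _ h')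

theorem iSup_subset_range_mulMap {p : ℕ} (N : Fin p → Subgroup G) (hN : ∀ i, (N i).Normal) :
    ((⨆ i, N i : Subgroup G) : Set G) ⊆ Set.range (mulMap N) := by
  induction p with
  | zero =>
    intro x hx
    rw [iSup_of_empty, SetLike.mem_coe, Subgroup.mem_bot] at hx
    exact ⟨fun i => i.elim0, by simp [mulMap, hx]⟩
  | succ p ih =>
    intro x hx
    have hle : (⨆ i, N i) ≤ N 0 ⊔ ⨆ i : Fin p, N i.succ := iSup_le fun i => by
      induction i using Fin.cases with
      | zero => exact le_sup_left
      | succ i => exact (le_iSup (fun i : Fin p => N i.succ) i).trans le_sup_right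
    have := hN 0
    obtain ⟨y, hy, z, hz, rfl⟩ := Subgroup.mem_sup_of_normal_left.1 (hle hx)
    obtain ⟨w, rfl⟩ := ih (fun i => N i.succ) (fun i => hN _) hz
    exact ⟨Fin.cons (⟨y, hy⟩ : N 0) w, by simp [mulMap, List.ofFn_succ]⟩

end

/-! ### Maximal and minimal closed normal subgroups -/

section

variable {G : Type*} [Group G] [TopologicalSpace G]

theorem maxClosedNormal.normal {K : Subgroup G} (hK : K ∈ maxClosedNormal G) : K.Normal :=
  hK.1.1

theorem maxClosedNormal.isClosed {K : Subgroup G} (hK : K ∈ maxClosedNormal G) :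
    IsClosed (K : Set G) :=
  hK.1.2.1

theorem maxClosedNormal.ne_top {K : Subgroup G} (hK : K ∈ maxClosedNormal G) : K ≠ ⊤ :=
  hK.1.2.2

theorem maxClosedNormal.eq_top_of_le {K L A : Subgroup G} (hK : K ∈ maxClosedNormal G)
    (hLn : L.Normal) (hLc : IsClosed (L : Set G)) (hKL : K ≤ L) (hA : A ≤ L) (hAK : ¬ A ≤ K) :
    L = ⊤ := by
  by_contra hL
  exact hAK (hA.trans (hK.2 ⟨hLn, hLc, hL⟩ hKL))

theorem maxClosedNormal.eq_of_le {K L : Subgroup G} (hK : K ∈ maxClosedNormal G)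
    (hL : L ∈ maxClosedNormal G) (h : K ≤ L) : K = L :=
  h.antisymm (hK.2 hL.1 h)

theorem Subgroup.isClosed_sInf {F : Set (Subgroup G)} (hF : ∀ N ∈ F, IsClosed (N : Set G)) :
    IsClosed ((sInf F : Subgroup G) : Set G) := by
  rw [Subgroup.coe_sInf]
  exact isClosed_biInter hF

theorem minClosedNormal.inf_eq_bot_of_not_le {M A : Subgroup G} (hM : M ∈ minClosedNormal G)
    (hAn : A.Normal) (hAc : IsClosed (A : Set G)) (h : ¬ M ≤ A) : M ⊓ A = ⊥ := by
  have := hM.1.1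
  by_contra hne
  exact h ((hM.2 ⟨Subgroup.normal_inf_normal M A, hM.1.2.1.inter hAc, hne⟩ inf_le_left).trans
    inf_le_right)

theorem minClosedNormal.exists_not_le (hmax : sInf (maxClosedNormal G) = ⊥) {M : Subgroup G}
    (hM : M ≠ ⊥) : ∃ K ∈ maxClosedNormal G, ¬ M ≤ K := by
  by_contra! h
  exact hM (le_bot_iff.1 (hmax ▸ le_sInf h))

end

/-! ### Density modulo a maximal closed normal subgroup -/

section

variable {G : Type*} [Group G] [TopologicalSpace G] [IsTopologicalGroup G]

theorem maxClosedNormal.topologicalClosure_sup_eq_top {K A : Subgroup G}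
    (hK : K ∈ maxClosedNormal G) [A.Normal] (hAK : ¬ A ≤ K) :
    (A ⊔ K).topologicalClosure = ⊤ := by
  have := maxClosedNormal.normal hK
  exact maxClosedNormal.eq_top_of_le hK (Subgroup.is_normal_topologicalClosure _)
    (Subgroup.isClosed_topologicalClosure _)
    (le_sup_right.trans (Subgroup.le_topologicalClosure _))
    (le_sup_left.trans (Subgroup.le_topologicalClosure _)) hAK

/-- A normal subgroup not contained in `K` has dense image in the topologically simple
group `G ⧸ K`. -/
theorem maxClosedNormal.topologicalClosure_map_mk_eq_top {K A : Subgroup G} [K.Normal] [A.Normal]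
    (hK : K ∈ maxClosedNormal G) (hAK : ¬ A ≤ K) :
    (A.map (QuotientGroup.mk' K)).topologicalClosure = ⊤ := by
  have hA : (A.map (QuotientGroup.mk' K)).Normal :=
    Subgroup.Normal.map ‹_› _ (QuotientGroup.mk'_surjective K)
  have hcl := Subgroup.is_normal_topologicalClosure (A.map (QuotientGroup.mk' K))
  have htop := maxClosedNormal.eq_top_of_le (A := A) hK
    (hcl.comap (QuotientGroup.mk' K))
    ((Subgroup.isClosed_topologicalClosure _).preimage QuotientGroup.continuous_mk)
    (fun k hk => by
      have : QuotientGroup.mk' K k = 1 := (QuotientGroup.eq_one_iff k).2 hk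
      rw [Subgroup.mem_comap, this]
      exact one_mem _)
    (fun a ha => Subgroup.le_topologicalClosure _ (Subgroup.mem_map_of_mem _ ha)) hAK
  rw [eq_top_iff]
  intro q _
  obtain ⟨g, rfl⟩ := QuotientGroup.mk'_surjective K q
  have : g ∈ ((A.map (QuotientGroup.mk' K)).topologicalClosure).comap (QuotientGroup.mk' K) := by
    rw [htop]; trivial
  exact this

theorem dense_mul_of_not_le {M K : Subgroup G} (hM : M ∈ minClosedNormal G)
    (hK : K ∈ maxClosedNormal G) (h : ¬ M ≤ K) : Dense ((M : Set G) * (K : Set G)) := by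
  have := hM.1.1
  have := hK.1.1
  rw [← Subgroup.mul_normal, dense_iff_closure_eq, ← Subgroup.topologicalClosure_coe,
    maxClosedNormal.topologicalClosure_sup_eq_top hK h, Subgroup.coe_top]

/-- The centraliser of a compact subset `C` of a discrete normal subgroup `N` is open: for `g`
near `1` the commutators of `g` with the elements of `C` lie in `N` and are close to `1`. -/
theorem Subgroup.isOpen_centralizer_of_isCompact {N U : Subgroup G} [N.Normal]
    (hU : IsOpen (U : Set G)) (hNU : N ⊓ U = ⊥) {C : Set G} (hC : IsCompact C)
    (hCN : C ⊆ N) : IsOpen (Subgroup.centralizer C : Set G) := by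
  refine Subgroup.isOpen_of_mem_nhds _ (g := 1) ?_
  have key : ∀ᶠ g in 𝓝 (1 : G), ∀ c ∈ C, g * c * g⁻¹ * c⁻¹ ∈ U := by
    refine hC.eventually_forall_of_forall_eventually fun c _ => ?_
    have hcont : Continuous fun z : G × G => z.1 * z.2 * z.1⁻¹ * z.2⁻¹ := by fun_prop
    exact hcont.continuousAt.eventually_mem (hU.mem_nhds (by simp))
  filter_upwards [key] with g hg
  refine Subgroup.mem_centralizer_iff.2 fun c hc => ?_
  have h1 : g * c * g⁻¹ * c⁻¹ ∈ N ⊓ U :=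
    ⟨N.mul_mem (Subgroup.Normal.conj_mem ‹_› c (hCN hc) g) (inv_mem (hCN hc)), hg c hc⟩
  rw [hNU, Subgroup.mem_bot, mul_inv_eq_one, mul_inv_eq_iff_eq_mul] at h1
  exact h1.symm

theorem NoNontrivialDiscreteQuotient.eq_top_of_isOpen
    (hquot : NoNontrivialDiscreteQuotient G) {N : Subgroup G} (hN : N.Normal)
    (hNo : IsOpen (N : Set G)) : N = ⊤ :=
  hquot N hN (QuotientGroup.discreteTopology hNo)

end

/-! ### Centralisers of minimal closed normal subgroups -/

section

variable {G : Type*} [Group G] [TopologicalSpace G] [IsTopologicalGroup G] [T2Space G]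

/-- `K` centralises `M` because `M ⊓ K = ⊥`, and it is maximal among the proper closed normal
subgroups, to which the centraliser of `M` belongs since the centre is trivial. -/
theorem minClosedNormal.centralizer_eq (hcentre : Subgroup.center G = ⊥) {M K : Subgroup G}
    (hM : M ∈ minClosedNormal G) (hK : K ∈ maxClosedNormal G) (h : ¬ M ≤ K) :
    Subgroup.centralizer (M : Set G) = K := by
  have := hM.1.1
  have hle := Subgroup.le_centralizer_of_inf_eq_bot hK.1.1 hM.1.1
    (inf_comm M K ▸ minClosedNormal.inf_eq_bot_of_not_le hM hK.1.1 hK.1.2.1 h)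
  refine (hle.antisymm (hK.2 ⟨Subgroup.normal_centralizer, Set.isClosed_centralizer _,
    fun htop => hM.1.2.2 ?_⟩ hle)).symm
  rw [Subgroup.centralizer_eq_top_iff_subset] at htop
  exact le_bot_iff.1 (hcentre ▸ htop)

theorem minClosedNormal.isQuasiFactor (hcentre : Subgroup.center G = ⊥)
    (hmax : sInf (maxClosedNormal G) = ⊥) {M : Subgroup G} (hM : M ∈ minClosedNormal G) :
    IsQuasiFactor M := by
  obtain ⟨K, hK, hMK⟩ := minClosedNormal.exists_not_le hmax hM.1.2.2
  refine ⟨hM.1.1, hM.1.2.1, ?_⟩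
  rw [minClosedNormal.centralizer_eq hcentre hM hK hMK]
  exact dense_mul_of_not_le hM hK hMK

end

/-! ### Compact open subgroups and cocompact normal subgroups -/

section

variable {G : Type*} [Group G] [TopologicalSpace G] [IsTopologicalGroup G] [T2Space G]
  [LocallyCompactSpace G] [TotallyDisconnectedSpace G]

/-- Van Dantzig's theorem: the compact open subgroups of a totally disconnected locally compact
group form a basis of neighbourhoods of the identity. -/
theorem exists_isCompact_isOpen_subgroup_subset {W : Set G} (hW : W ∈ 𝓝 (1 : G)) :
    ∃ U : Subgroup G, IsOpen (U : Set G) ∧ IsCompact (U : Set G) ∧ (U : Set G) ⊆ W := by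
  obtain ⟨C, hC, hCW, hCc⟩ := local_compact_nhds hW
  obtain ⟨D, hD, h1D, hDC⟩ := loc_compact_Haus_tot_disc_of_zero_dim.mem_nhds_iff.1 hC
  have hDc : IsCompact D := hCc.of_isClosed_subset hD.isClosed hDC
  obtain ⟨T, hT, hTD⟩ := compact_open_separated_mul_left hDc hD.isOpen subset_rfl
  -- The stabiliser of a compact open set `D ∋ 1` is an open subgroup contained in `D`.
  let U : Subgroup G := MulAction.stabilizer G D
  have hUD : (U : Set G) ⊆ D := fun g hg => by
    have hg' : g • D = D := hg
    rw [← hg']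
    exact ⟨1, h1D, by simp⟩
  have hUo : IsOpen (U : Set G) := by
    refine Subgroup.isOpen_of_mem_nhds U (g := 1) ?_
    have hT' : T⁻¹ ∈ 𝓝 (1 : G) := inv_mem_nhds_one G hT
    filter_upwards [hT, hT'] with g hg hg'
    refine MulAction.mem_stabilizer_iff.2 (Set.Subset.antisymm ?_ ?_)
    · rintro _ ⟨d, hd, rfl⟩
      exact hTD (Set.mul_mem_mul hg hd)
    · intro d hd
      exact ⟨g⁻¹ * d, hTD (Set.mul_mem_mul hg' hd), by simp⟩
  exact ⟨U, hUo, hDc.of_isClosed_subset (Subgroup.isClosed_of_isOpen U hUo) hUD,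
    hUD.trans (hDC.trans hCW)⟩

/-- As the open subgroup `U` shrinks, the sets `U * K` intersect in the closure of `K`. -/
theorem Subgroup.eq_top_of_isClosed_of_forall_sup_eq_top {K : Subgroup G} [K.Normal]
    (hK : IsClosed (K : Set G))
    (h : ∀ U : Subgroup G, IsOpen (U : Set G) → U ⊔ K = ⊤) : K = ⊤ := by
  rw [eq_top_iff]
  intro x _
  rw [← SetLike.mem_coe, ← hK.closure_eq, mem_closure_iff_nhds_one]
  intro W hW
  obtain ⟨U, hUo, -, hUW⟩ := exists_isCompact_isOpen_subgroup_subset hW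
  have hx : x ∈ U ⊔ K := by rw [h U hUo]; trivial
  obtain ⟨u, hu, k, hk, rfl⟩ := Subgroup.mem_sup_of_normal_right.1 hx
  exact ⟨k, hk, hUW (by simpa using inv_mem hu)⟩

/-- Without non-trivial discrete quotients there is no non-trivial compact quotient either: a
compact quotient of `G` is profinite, so it would have a non-trivial finite quotient. -/
theorem NoNontrivialDiscreteQuotient.eq_top_of_cocompact
    (hquot : NoNontrivialDiscreteQuotient G) {K : Subgroup G} [K.Normal]
    (hK : IsClosed (K : Set G)) {C : Set G} (hC : IsCompact C) (hCK : C * (K : Set G) = Set.univ) :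
    K = ⊤ := by
  refine Subgroup.eq_top_of_isClosed_of_forall_sup_eq_top hK fun U hU => ?_
  set H : Subgroup G := U ⊔ K
  have hHo : IsOpen (H : Set G) := Subgroup.isOpen_mono le_sup_left hU
  have : DiscreteTopology (G ⧸ H) := QuotientGroup.discreteTopology hHo
  have hcov : (QuotientGroup.mk '' C : Set (G ⧸ H)) = Set.univ := by
    refine Set.eq_univ_of_forall fun q => ?_
    obtain ⟨g, rfl⟩ := QuotientGroup.mk_surjective q
    have hg : g ∈ C * (K : Set G) := hCK ▸ Set.mem_univ g
    obtain ⟨c, hc, k, hk, rfl⟩ := hg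
    exact ⟨c, hc, QuotientGroup.eq.2 (by simpa using Subgroup.mem_sup_right hk)⟩
  have hfin : (Set.univ : Set (G ⧸ H)).Finite :=
    hcov ▸ (hC.image QuotientGroup.continuous_mk).finite_of_discrete
  have : Finite (G ⧸ H) := Set.finite_univ_iff.1 hfin
  have : H.FiniteIndex := Subgroup.finiteIndex_of_finite_quotient
  -- The normal core of an open subgroup of finite index is open.
  have hcore : H.normalCore = ⊤ := hquot.eq_top_of_isOpen H.normalCore_normal
    (Subgroup.isOpen_of_isClosed_of_finiteIndex _
      (H.normalCore_isClosed (Subgroup.isClosed_of_isOpen H hHo)))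
  exact top_le_iff.1 (hcore ▸ H.normalCore_le)

end

/-! ### Topologically simple quotients -/

section

variable {G : Type*} [Group G] [TopologicalSpace G] [IsTopologicalGroup G] [T2Space G]
  [LocallyCompactSpace G] [TotallyDisconnectedSpace G]

/-- Maximal closed normal subgroups are prime for the commutator: otherwise `G ⧸ K` contains two
dense subgroups that commute, so it is abelian; then every open subgroup maps onto `G ⧸ K`, being
normal there with discrete quotient, so `G ⧸ K` is trivial. -/
theorem maxClosedNormal.le_or_le_of_commutator_le (hquot : NoNontrivialDiscreteQuotient G)
    {K A B : Subgroup G} (hK : K ∈ maxClosedNormal G) [A.Normal] [B.Normal] (h : ⁅A, B⁆ ≤ K) :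
    A ≤ K ∨ B ≤ K := by
  have := maxClosedNormal.normal hK
  have hKc := maxClosedNormal.isClosed hK
  by_contra! hAB
  have hA := maxClosedNormal.topologicalClosure_map_mk_eq_top hK hAB.1
  have hB := maxClosedNormal.topologicalClosure_map_mk_eq_top hK hAB.2
  -- What commutes with a dense subgroup commutes with everything.
  have dense_le : ∀ {P Q : Subgroup (G ⧸ K)}, P.topologicalClosure = ⊤ →
      P ≤ Subgroup.centralizer Q → Q ≤ Subgroup.centralizer ((⊤ : Subgroup (G ⧸ K)) : Set _) := by
    intro P Q hP hPQ
    rw [Subgroup.le_centralizer_iff, ← hP]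
    exact Subgroup.topologicalClosure_minimal _ hPQ (Set.isClosed_centralizer _)
  have hcomm : B.map (QuotientGroup.mk' K) ≤
      Subgroup.centralizer (A.map (QuotientGroup.mk' K) : Set (G ⧸ K)) := by
    rintro _ ⟨b, hb, rfl⟩
    refine Subgroup.mem_centralizer_iff_commutator_eq_one.2 ?_
    rintro _ ⟨a, ha, rfl⟩
    rw [← map_commutatorElement]
    exact (QuotientGroup.eq_one_iff _).2 (h (Subgroup.commutator_mem_commutator ha hb))
  have hcen : (⊤ : Subgroup (G ⧸ K)) ≤
      Subgroup.centralizer ((⊤ : Subgroup (G ⧸ K)) : Set _) :=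
    dense_le hA (dense_le hB hcomm)
  -- `G ⧸ K` is commutative, so every subgroup containing `K` is normal.
  refine maxClosedNormal.ne_top hK
    (Subgroup.eq_top_of_isClosed_of_forall_sup_eq_top hKc fun U hU => ?_)
  refine hquot.eq_top_of_isOpen ⟨fun x hx g => ?_⟩ (Subgroup.isOpen_mono le_sup_left hU)
  have hgx : g * x * g⁻¹ * x⁻¹ ∈ K := by
    refine (QuotientGroup.eq_one_iff _).1 ?_
    exact Subgroup.mem_centralizer_iff_commutator_eq_one.1
      (hcen (Subgroup.mem_top (x : G ⧸ K))) (g : G ⧸ K) (Subgroup.mem_top _)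
  simpa using mul_mem (Subgroup.mem_sup_right hgx : _ ∈ U ⊔ K) hx

theorem maxClosedNormal.le_or_le_of_inf_le (hquot : NoNontrivialDiscreteQuotient G)
    {K A B : Subgroup G} (hK : K ∈ maxClosedNormal G) [A.Normal] [B.Normal] (h : A ⊓ B ≤ K) :
    A ≤ K ∨ B ≤ K :=
  maxClosedNormal.le_or_le_of_commutator_le hquot hK ((Subgroup.commutator_le_inf A B).trans h)

theorem maxClosedNormal.inf_ne_bot (hquot : NoNontrivialDiscreteQuotient G) {K A B : Subgroup G}
    (hK : K ∈ maxClosedNormal G) [A.Normal] [B.Normal] (hA : ¬ A ≤ K) (hB : ¬ B ≤ K) :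
    A ⊓ B ≠ ⊥ := fun h =>
  (maxClosedNormal.le_or_le_of_inf_le hquot hK (h.trans_le bot_le)).elim hA hB

theorem maxClosedNormal.exists_mem_le_of_sInf_le (hquot : NoNontrivialDiscreteQuotient G)
    {K : Subgroup G} (hK : K ∈ maxClosedNormal G) {F : Set (Subgroup G)} (hF : F.Finite)
    (hn : ∀ N ∈ F, N.Normal) (h : sInf F ≤ K) : ∃ N ∈ F, N ≤ K := by
  induction F, hF using Set.Finite.induction_on with
  | empty => exact absurd (top_le_iff.1 (sInf_empty.symm.trans_le h)) (maxClosedNormal.ne_top hK)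
  | @insert A F _ _ ih =>
    have := hn A (Set.mem_insert A F)
    have := Subgroup.normal_sInf fun N hN => hn N (Set.mem_insert_of_mem A hN)
    rw [sInf_insert] at h
    rcases maxClosedNormal.le_or_le_of_inf_le hquot hK h with h | h
    · exact ⟨A, Set.mem_insert A F, h⟩
    · obtain ⟨N, hN, hNK⟩ := ih (fun N hN => hn N (Set.mem_insert_of_mem A hN)) h
      exact ⟨N, Set.mem_insert_of_mem A hN, hNK⟩

/-- A compact normal subgroup dies in every topologically simple quotient `G ⧸ K`, since otherwise
its image would be all of `G ⧸ K`, which would then be compact. -/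
theorem maxClosedNormal.le_of_isCompact (hquot : NoNontrivialDiscreteQuotient G)
    {K C : Subgroup G} (hK : K ∈ maxClosedNormal G) [C.Normal] (hC : IsCompact (C : Set G)) :
    C ≤ K := by
  have := maxClosedNormal.normal hK
  have hKc := maxClosedNormal.isClosed hK
  by_contra hCK
  have hcl : IsClosed ((C ⊔ K : Subgroup G) : Set G) := by
    rw [Subgroup.mul_normal]
    exact hKc.mul_left_of_isCompact hC
  have htop := maxClosedNormal.eq_top_of_le hK (Subgroup.sup_normal C K) hcl le_sup_right
    le_sup_left hCK
  refine maxClosedNormal.ne_top hK (hquot.eq_top_of_cocompact hKc hC ?_)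
  rw [← Subgroup.mul_normal, htop, Subgroup.coe_top]

/-- A discrete normal subgroup `N` of a compactly generated group dies in every topologically
simple quotient `G ⧸ K`. Otherwise its image is dense there, so a compact open subgroup `U`
and finitely many elements of `N` generate `G` modulo `K`. The part `V` of `U` that
centralises the `U`-conjugates of these elements is open, and `V * K` is normal. Hence `V * K
= G`, and `K` is cocompact. -/
theorem maxClosedNormal.le_of_inf_eq_bot (hgen : IsCompactlyGeneratedGroup G)
    (hquot : NoNontrivialDiscreteQuotient G)
    {K N U : Subgroup G} (hK : K ∈ maxClosedNormal G) [N.Normal] (hUo : IsOpen (U : Set G))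
    (hUc : IsCompact (U : Set G)) (hNU : N ⊓ U = ⊥) : N ≤ K := by
  have := maxClosedNormal.normal hK
  by_contra hNK
  have hdense := maxClosedNormal.topologicalClosure_sup_eq_top hK hNK
  obtain ⟨S, hS, hStop⟩ := hgen
  have hH : IsOpen ((U ⊔ K : Subgroup G) : Set G) := Subgroup.isOpen_mono le_sup_left hUo
  -- `N ⊔ K` is dense and `U ⊔ K` is open, so finitely many `n ∈ N` generate `G` with `U ⊔ K`.
  obtain ⟨F, hF⟩ := hS.elim_finite_subcover
    (fun n : N => (n : G) • ((U ⊔ K : Subgroup G) : Set G)) (fun n => hH.smul _) (by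
      intro s _
      have hs : s ∈ closure ((N ⊔ K : Subgroup G) : Set G) := by
        rw [← Subgroup.topologicalClosure_coe, hdense]; trivial
      obtain ⟨_, ⟨u, hu, rfl⟩, hx⟩ := mem_closure_iff.1 hs (s • (U : Set G)) (hUo.smul s)
        ⟨1, one_mem U, by simp⟩
      obtain ⟨n, hn, k, hk, hnk⟩ := Subgroup.mem_sup_of_normal_right.1 hx
      refine Set.mem_iUnion.2 ⟨⟨n, hn⟩, k * u⁻¹, mul_mem (Subgroup.mem_sup_right hk)
        (Subgroup.mem_sup_left (inv_mem hu)), ?_⟩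
      have : n * k = s * u := hnk
      simp [← mul_assoc, this])
  -- The set of `U`-conjugates of `F`: with it, the centraliser of `C` is normalised by `U`.
  let C : Set G :=
    (fun z : G × G => z.1 * z.2 * z.1⁻¹) '' ((U : Set G) ×ˢ (Subtype.val '' (F : Set N)))
  have hC : IsCompact C :=
    (hUc.prod (F.finite_toSet.image _).isCompact).image (by fun_prop)
  have hFC : ∀ n ∈ F, (n : G) ∈ C := fun n hn =>
    ⟨(1, n), ⟨one_mem U, n, hn, rfl⟩, by simp⟩
  have hCN : C ⊆ N := by
    rintro _ ⟨⟨u, _⟩, ⟨-, n, -, rfl⟩, rfl⟩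
    exact Subgroup.Normal.conj_mem ‹_› _ n.2 u
  have hCU : ∀ u ∈ U, ∀ c ∈ C, u * c * u⁻¹ ∈ C := by
    rintro u hu _ ⟨⟨v, m⟩, ⟨hv, hm⟩, rfl⟩
    exact ⟨(u * v, m), ⟨mul_mem hu hv, hm⟩, by simp [mul_assoc]⟩
  set V : Subgroup G := U ⊓ Subgroup.centralizer C
  have hVo : IsOpen (V : Set G) :=
    hUo.inter (Subgroup.isOpen_centralizer_of_isCompact hUo hNU hC hCN)
  have hUV : ∀ u ∈ U, ∀ x ∈ V, u * x * u⁻¹ ∈ V := by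
    refine fun u hu x hx => ⟨U.mul_mem (U.mul_mem hu hx.1) (U.inv_mem hu), ?_⟩
    refine Subgroup.mem_centralizer_iff.2 fun c hc => ?_
    have h1 := Subgroup.mem_centralizer_iff.1 hx.2 _ (hCU u⁻¹ (inv_mem hu) c hc)
    rw [inv_inv] at h1
    calc c * (u * x * u⁻¹) = u * (u⁻¹ * c * u * x) * u⁻¹ := by group
      _ = u * (x * (u⁻¹ * c * u)) * u⁻¹ := by rw [h1]
      _ = u * x * u⁻¹ * c := by group
  -- To normalise `V ⊔ K` it is enough, `K` being normal, to conjugate `V` into it.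
  have hle : ∀ A : Subgroup G, (∀ a ∈ A, ∀ x ∈ V, a * x * a⁻¹ ∈ V ⊔ K) →
      A ≤ Subgroup.normalizer ((V ⊔ K : Subgroup G) : Set G) := by
    have step : ∀ g : G, (∀ x ∈ V, g * x * g⁻¹ ∈ V ⊔ K) → ∀ y ∈ V ⊔ K, g * y * g⁻¹ ∈ V ⊔ K := by
      intro g hg y hy
      obtain ⟨v, hv, k, hk, rfl⟩ := Subgroup.mem_sup_of_normal_right.1 hy
      have : g * (v * k) * g⁻¹ = (g * v * g⁻¹) * (g * k * g⁻¹) := by group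
      rw [this]
      exact mul_mem (hg v hv) (Subgroup.mem_sup_right (Subgroup.Normal.conj_mem ‹_› k hk g))
    refine fun A hA a ha =>
      Subgroup.mem_normalizer_iff.2 fun y => ⟨step a (hA a ha) y, fun hy => ?_⟩
    have := step a⁻¹ (hA a⁻¹ (inv_mem ha)) _ hy
    simpa [mul_assoc] using this
  have hnU := hle U fun u hu x hx => Subgroup.mem_sup_left (hUV u hu x hx)
  have hnK := hle K fun k hk x hx =>
    (Subgroup.mem_normalizer_iff.1 (Subgroup.le_normalizer (Subgroup.mem_sup_right hk)) x).1
      (Subgroup.mem_sup_left hx)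
  have hnC := hle (Subgroup.closure C) fun c hc x hx => by
    have hcomm : c ∈ Subgroup.centralizer ({x} : Set G) := by
      refine (Subgroup.closure_le _).2 (fun d hd => ?_) hc
      exact Subgroup.mem_centralizer_singleton_iff.2 (Subgroup.mem_centralizer_iff.1 hx.2 d hd)
    rw [Subgroup.mem_centralizer_singleton_iff.1 hcomm, mul_inv_cancel_right]
    exact Subgroup.mem_sup_left hx
  -- `U`, `K` and `F` generate `G`.
  have hVK : (V ⊔ K).Normal := by
    rw [← Subgroup.normalizer_eq_top_iff, eq_top_iff, ← hStop, Subgroup.closure_le]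
    intro s hs
    obtain ⟨n, hn, h, hh, rfl⟩ := Set.mem_iUnion₂.1 (hF hs)
    exact mul_mem (hnC (Subgroup.subset_closure (hFC n hn))) (sup_le hnU hnK hh)
  have htop := hquot.eq_top_of_isOpen hVK (Subgroup.isOpen_mono le_sup_left hVo)
  have hUK : U ⊔ K = ⊤ := top_le_iff.1 (htop ▸ sup_le_sup_right inf_le_left K)
  refine maxClosedNormal.ne_top hK
    (hquot.eq_top_of_cocompact (maxClosedNormal.isClosed hK) hUc ?_)
  rw [← Subgroup.mul_normal, hUK, Subgroup.coe_top]

end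

/-! ### Filtering families, and existence of maximal and minimal subgroups -/

section

variable {G : Type*} [Group G] [TopologicalSpace G] [IsTopologicalGroup G] [T2Space G]
  [LocallyCompactSpace G] [TotallyDisconnectedSpace G]

/-- A filtering family of closed normal subgroups with trivial intersection contains the trivial
subgroup. A small enough member `N` meets a compact open subgroup `U` so close to the identity
that the generators cannot conjugate `N ⊓ U` out of `U`; so `N ⊓ U` is normal in `G`. -/
theorem bot_mem_of_directedOn_of_sInf_eq_bot (hgen : IsCompactlyGeneratedGroup G)
    (hquot : NoNontrivialDiscreteQuotient G) (hmax : sInf (maxClosedNormal G) = ⊥)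
    {F : Set (Subgroup G)} (hne : F.Nonempty) (hF : ∀ N ∈ F, N.Normal ∧ IsClosed (N : Set G))
    (hdir : DirectedOn (· ≥ ·) F) (hinf : sInf F = ⊥) : ⊥ ∈ F := by
  obtain ⟨U, hUo, hUc, -⟩ := exists_isCompact_isOpen_subgroup_subset (G := G) Filter.univ_mem
  obtain ⟨S, hS, hStop⟩ := hgen
  have key : ∀ᶠ g in 𝓝 (1 : G), ∀ s ∈ S ∪ S⁻¹, s * g * s⁻¹ ∈ U := by
    refine (hS.union hS.inv).eventually_forall_of_forall_eventually fun s _ => ?_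
    have hcont : Continuous fun z : G × G => z.2 * z.1 * z.2⁻¹ := by fun_prop
    exact hcont.continuousAt.eventually_mem (hUo.mem_nhds (by simp))
  obtain ⟨O, hO, hOo, h1O⟩ := eventually_nhds_iff.1 key
  have : Nonempty F := hne.to_subtype
  -- The compact set `U \ O` misses the intersection of `F`, hence misses some member `N`.
  obtain ⟨⟨N, hNF⟩, hN⟩ := (hUc.diff hOo).elim_directed_family_closed
    (fun N : F => ((N : Subgroup G) : Set G)) (fun N => (hF N N.2).2) (by
      refine Set.eq_empty_of_forall_notMem fun x hx => hx.1.2 ?_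
      have : x ∈ sInf F := Subgroup.mem_sInf.2 fun N hN => Set.mem_iInter.1 hx.2 ⟨N, hN⟩
      rw [hinf, Subgroup.mem_bot] at this
      exact this ▸ h1O) (by
      rintro ⟨A, hA⟩ ⟨B, hB⟩
      obtain ⟨D, hD, h1, h2⟩ := hdir A hA B hB
      exact ⟨⟨D, hD⟩, h1, h2⟩)
  have hNn := (hF N hNF).1
  have hNO : ∀ x ∈ N ⊓ U, x ∈ O := fun x hx => by
    by_contra hxO
    exact Set.notMem_empty x (hN ▸ ⟨⟨hx.2, hxO⟩, hx.1⟩)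
  -- So `N ⊓ U ⊆ O`, and conjugation by a generator keeps `N ⊓ U` inside `U`.
  have hnorm : (N ⊓ U).Normal := by
    refine Subgroup.normal_of_conj_mem_of_closure_eq_top hStop (fun s hs x hx => ?_)
      fun s hs x hx => ?_
    · exact ⟨hNn.conj_mem x hx.1 s, hO x (hNO x hx) s (Or.inl hs)⟩
    · have h1 := hO x (hNO x hx) s⁻¹ (Or.inr (Set.inv_mem_inv.2 hs))
      have h2 := hNn.conj_mem x hx.1 s⁻¹
      rw [inv_inv] at h1 h2
      exact ⟨h2, h1⟩
  -- `N ⊓ U` is compact and normal, hence trivial; so `N` is discrete, hence trivial.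
  have hNU : N ⊓ U = ⊥ := by
    rw [← le_bot_iff, ← hmax]
    exact le_sInf fun K hK => maxClosedNormal.le_of_isCompact hquot hK
      (hUc.inter_left (hF N hNF).2)
  have hNbot : N = ⊥ := by
    rw [← le_bot_iff, ← hmax]
    exact le_sInf fun K hK =>
      maxClosedNormal.le_of_inf_eq_bot ⟨S, hS, hStop⟩ hquot hK hUo hUc hNU
  exact hNbot ▸ hNF

/-- The finite intersections of maximal closed normal subgroups form a filtering family, so one of
them is trivial; by primeness every maximal closed normal subgroup occurs in it. -/
theorem finite_maxClosedNormal (hgen : IsCompactlyGeneratedGroup G)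
    (hquot : NoNontrivialDiscreteQuotient G) (hmax : sInf (maxClosedNormal G) = ⊥) :
    (maxClosedNormal G).Finite := by
  have hbot : ⊥ ∈ sInf '' {T : Set (Subgroup G) | T ⊆ maxClosedNormal G ∧ T.Finite} := by
    refine bot_mem_of_directedOn_of_sInf_eq_bot hgen hquot hmax
      ⟨_, ∅, ⟨Set.empty_subset _, Set.finite_empty⟩, rfl⟩ ?_ ?_ ?_
    · rintro _ ⟨T, ⟨hT, -⟩, rfl⟩
      exact ⟨Subgroup.normal_sInf fun N hN => (hT hN).1.1,
        Subgroup.isClosed_sInf fun N hN => (hT hN).1.2.1⟩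
    · rintro _ ⟨T, hT, rfl⟩ _ ⟨T', hT', rfl⟩
      exact ⟨_, ⟨T ∪ T', ⟨Set.union_subset hT.1 hT'.1, hT.2.union hT'.2⟩, rfl⟩,
        sInf_le_sInf Set.subset_union_left, sInf_le_sInf Set.subset_union_right⟩
    · rw [← le_bot_iff, ← hmax]
      refine le_sInf fun K hK => sInf_le ⟨{K}, ⟨?_, Set.finite_singleton K⟩, sInf_singleton⟩
      exact Set.singleton_subset_iff.2 hK
  obtain ⟨T, ⟨hT, hTf⟩, hTbot⟩ := hbot
  refine hTf.subset fun K hK => ?_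
  obtain ⟨N, hN, hNK⟩ := maxClosedNormal.exists_mem_le_of_sInf_le hquot hK hTf
    (fun N hN => (hT hN).1.1) (hTbot.trans_le bot_le)
  exact maxClosedNormal.eq_of_le (hT hN) hK hNK ▸ hN

/-- Zorn's lemma applies because a chain of non-trivial closed normal subgroups has non-trivial
intersection. -/
theorem exists_minClosedNormal_le (hgen : IsCompactlyGeneratedGroup G)
    (hquot : NoNontrivialDiscreteQuotient G) (hmax : sInf (maxClosedNormal G) = ⊥)
    {A : Subgroup G} (hAn : A.Normal) (hAc : IsClosed (A : Set G)) (hA : A ≠ ⊥) :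
    ∃ M ∈ minClosedNormal G, M ≤ A := by
  obtain ⟨M, hMA, hM⟩ := zorn_le_nonempty₀ (α := (Subgroup G)ᵒᵈ)
    {M | (OrderDual.ofDual M).Normal ∧ IsClosed ((OrderDual.ofDual M : Subgroup G) : Set G) ∧
      OrderDual.ofDual M ≠ ⊥} (fun c hc hchain y hy => by
      have hc' : ∀ N : Subgroup G, OrderDual.toDual N ∈ c →
        N.Normal ∧ IsClosed (N : Set G) ∧ N ≠ ⊥ := fun N hN => hc hN
      let F : Set (Subgroup G) := {N | OrderDual.toDual N ∈ c}
      refine ⟨OrderDual.toDual (sInf F), ⟨Subgroup.normal_sInf fun N hN => (hc' N hN).1,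
        Subgroup.isClosed_sInf fun N hN => (hc' N hN).2.1, fun h => ?_⟩,
        fun z hz => sInf_le (show OrderDual.ofDual z ∈ F from hz)⟩
      refine (hc' ⊥ (bot_mem_of_directedOn_of_sInf_eq_bot hgen hquot hmax (F := F) ⟨y, hy⟩
        (fun N hN => ⟨(hc' N hN).1, (hc' N hN).2.1⟩) ?_ h)).2.2 rfl
      exact hchain.directedOn) (OrderDual.toDual A) ⟨hAn, hAc, hA⟩
  exact ⟨OrderDual.ofDual M, ⟨hM.1, fun B hB h => hM.2 (y := OrderDual.toDual B) hB h⟩, hMA⟩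

/-- Zorn's lemma applies because the union of a chain of proper closed normal subgroups is not
dense. -/
theorem exists_le_maxClosedNormal (hgen : IsCompactlyGeneratedGroup G)
    (hquot : NoNontrivialDiscreteQuotient G)
    {A : Subgroup G} (hAn : A.Normal) (hAc : IsClosed (A : Set G)) (hA : A ≠ ⊤) :
    ∃ K ∈ maxClosedNormal G, A ≤ K := by
  obtain ⟨K, hAK, hK⟩ := zorn_le_nonempty₀
    {M : Subgroup G | M.Normal ∧ IsClosed (M : Set G) ∧ M ≠ ⊤} (fun c hc hchain y hy => by
      have := Subgroup.sSup_normal c fun N hN => (hc hN).1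
      refine ⟨(sSup c).topologicalClosure, ⟨Subgroup.is_normal_topologicalClosure _,
        Subgroup.isClosed_topologicalClosure _, fun htop => ?_⟩,
        fun z hz => (le_sSup hz).trans (Subgroup.le_topologicalClosure _)⟩
      obtain ⟨U, hUo, hUc, -⟩ := exists_isCompact_isOpen_subgroup_subset (G := G) Filter.univ_mem
      obtain ⟨S, hS, hStop⟩ := hgen
      have : Nonempty c := ⟨⟨y, hy⟩⟩
      -- If the union of the chain is dense, a member `N` has `U ⊔ N = ⊤`, so is cocompact.
      obtain ⟨⟨N, hN⟩, hSN⟩ := hS.elim_directed_cover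
        (fun N : c => ((U ⊔ N : Subgroup G) : Set G))
        (fun N => Subgroup.isOpen_mono le_sup_left hUo) (by
          intro s _
          have hs : s ∈ closure ((sSup c : Subgroup G) : Set G) := by
            rw [← Subgroup.topologicalClosure_coe, htop]; trivial
          obtain ⟨x, ⟨u, hu, hux⟩, hx⟩ := mem_closure_iff.1 hs (MulOpposite.op s • (U : Set G))
            (hUo.smul _) ⟨1, one_mem U, by simp⟩
          obtain ⟨N, hN, hxN⟩ := (Subgroup.mem_sSup_of_directedOn ⟨y, hy⟩ hchain.directedOn).1 hx
          refine Set.mem_iUnion.2 ⟨⟨N, hN⟩, ?_⟩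
          have hux' : u * s = x := hux
          have : s = u⁻¹ * x := by rw [← hux', inv_mul_cancel_left]
          rw [this]
          exact mul_mem (Subgroup.mem_sup_left (inv_mem hu)) (Subgroup.mem_sup_right hxN)) (by
          rintro ⟨A, hA⟩ ⟨B, hB⟩
          rcases hchain.total hA hB with h | h
          · exact ⟨⟨B, hB⟩, sup_le_sup_left h U, subset_rfl⟩
          · exact ⟨⟨A, hA⟩, subset_rfl, sup_le_sup_left h U⟩)
      have := (hc hN).1
      have hUN : U ⊔ N = ⊤ := top_le_iff.1 (hStop ▸ (Subgroup.closure_le _).2 hSN)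
      refine (hc hN).2.2 (hquot.eq_top_of_cocompact (hc hN).2.1 hUc ?_)
      rw [← Subgroup.mul_normal, hUN, Subgroup.coe_top]) A ⟨hAn, hAc, hA⟩
  exact ⟨K, hK, hAK⟩

/-- Such an `M` is found inside the intersection of the maximal closed normal subgroups other than
`K`, which is non-trivial. -/
theorem exists_minClosedNormal_not_le (hgen : IsCompactlyGeneratedGroup G)
    (hquot : NoNontrivialDiscreteQuotient G) (hmax : sInf (maxClosedNormal G) = ⊥)
    {K : Subgroup G} (hK : K ∈ maxClosedNormal G) : ∃ M ∈ minClosedNormal G, ¬ M ≤ K := by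
  have hprop : ∀ N ∈ maxClosedNormal G \ {K}, N.Normal := fun N hN => hN.1.1.1
  -- The intersection of the other maximal subgroups is not below `K`, as `K` is prime.
  have hnot : ¬ sInf (maxClosedNormal G \ {K}) ≤ K := fun h => by
    obtain ⟨N, hN, hNK⟩ := maxClosedNormal.exists_mem_le_of_sInf_le hquot hK
      ((finite_maxClosedNormal hgen hquot hmax).subset Set.sdiff_subset) hprop h
    exact hN.2 (maxClosedNormal.eq_of_le hN.1 hK hNK)
  obtain ⟨M, hM, hMle⟩ := exists_minClosedNormal_le hgen hquot hmax
    (Subgroup.normal_sInf hprop) (Subgroup.isClosed_sInf fun N hN => hN.1.1.2.1)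
    fun h => hnot (h.trans_le bot_le)
  refine ⟨M, hM, fun hMK => hM.1.2.2 (le_bot_iff.1 (hmax ▸ le_sInf fun N hN => ?_))⟩
  by_cases hNK : N = K
  · exact hNK ▸ hMK
  · exact hMle.trans (sInf_le ⟨hN, hNK⟩)

end

/-! ### The correspondence and the quasi-product decomposition -/

section

variable {G : Type*} [Group G] [TopologicalSpace G] [IsTopologicalGroup G] [T2Space G]
  [LocallyCompactSpace G] [TotallyDisconnectedSpace G]

/-- Two minimal subgroups with the same centraliser `K` are both not contained in `K`; as `K` is
prime they intersect non-trivially, so they coincide. -/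
theorem bijOn_centralizer (hgen : IsCompactlyGeneratedGroup G)
    (hcentre : Subgroup.center G = ⊥)
    (hquot : NoNontrivialDiscreteQuotient G) (hmax : sInf (maxClosedNormal G) = ⊥) :
    Set.BijOn (fun N : Subgroup G => Subgroup.centralizer (N : Set G))
      (minClosedNormal G) (maxClosedNormal G) := by
  refine ⟨fun M hM => ?_, fun M hM M' hM' h => ?_, fun K hK => ?_⟩
  · obtain ⟨K, hK, hMK⟩ := minClosedNormal.exists_not_le hmax hM.1.2.2
    dsimp only
    rwa [minClosedNormal.centralizer_eq hcentre hM hK hMK]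
  · obtain ⟨K, hK, hMK⟩ := minClosedNormal.exists_not_le hmax hM.1.2.2
    obtain ⟨K', hK', hMK'⟩ := minClosedNormal.exists_not_le hmax hM'.1.2.2
    dsimp only at h
    rw [minClosedNormal.centralizer_eq hcentre hM hK hMK,
      minClosedNormal.centralizer_eq hcentre hM' hK' hMK'] at h
    subst h
    have := hM.1.1
    have := hM'.1.1
    have hne := maxClosedNormal.inf_ne_bot hquot hK hMK hMK'
    have h1 : M ≤ M' := by
      by_contra h1
      exact hne (minClosedNormal.inf_eq_bot_of_not_le hM hM'.1.1 hM'.1.2.1 h1)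
    exact h1.antisymm (hM'.2 hM.1 h1)
  · obtain ⟨M, hM, hMK⟩ := exists_minClosedNormal_not_le hgen hquot hmax hK
    exact ⟨M, hM, minClosedNormal.centralizer_eq hcentre hM hK hMK⟩

theorem maxClosedNormal.isQuasiFactor (hgen : IsCompactlyGeneratedGroup G)
    (hquot : NoNontrivialDiscreteQuotient G) (hmax : sInf (maxClosedNormal G) = ⊥)
    {K : Subgroup G} (hK : K ∈ maxClosedNormal G) : IsQuasiFactor K := by
  obtain ⟨M, hM, hMK⟩ := exists_minClosedNormal_not_le hgen hquot hmax hK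
  refine ⟨hK.1.1, hK.1.2.1, (dense_mul_of_not_le hM hK hMK).mono ?_⟩
  have := hM.1.1
  have := hK.1.1
  rw [← Subgroup.mul_normal, sup_comm, Subgroup.mul_normal]
  exact Set.mul_subset_mul_left (Subgroup.le_centralizer_of_inf_eq_bot hM.1.1 hK.1.1
    (minClosedNormal.inf_eq_bot_of_not_le hM hK.1.1 hK.1.2.1 hMK))

/-- Modulo the centraliser of `N i` the product `x₁ ⋯ x_p` reduces to `x_i`, which gives
injectivity. No maximal closed normal subgroup contains all the `N i`, which gives density. -/
theorem isQuasiProduct_of_range_eq (hgen : IsCompactlyGeneratedGroup G)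
    (hcentre : Subgroup.center G = ⊥)
    (hquot : NoNontrivialDiscreteQuotient G) (hmax : sInf (maxClosedNormal G) = ⊥)
    {p : ℕ} (N : Fin p → Subgroup G) (hinj : Function.Injective N)
    (hN : Set.range N = minClosedNormal G) : IsQuasiProduct N := by
  have hmem : ∀ i, N i ∈ minClosedNormal G := fun i => hN ▸ Set.mem_range_self i
  have hn : ∀ i, (N i).Normal := fun i => (hmem i).1.1
  refine ⟨hn, fun i => (hmem i).1.2.1, fun x y hxy => funext fun i => ?_, ?_⟩
  · obtain ⟨K, hK, hMK⟩ := minClosedNormal.exists_not_le hmax (hmem i).1.2.2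
    have := hK.1.1
    have hle : ∀ j, j ≠ i → N j ≤ K := fun j hj => by
      by_contra hjK
      refine hj (hinj ((bijOn_centralizer hgen hcentre hquot hmax).injOn (hmem j) (hmem i) ?_))
      exact (minClosedNormal.centralizer_eq hcentre (hmem j) hK hjK).trans
        (minClosedNormal.centralizer_eq hcentre (hmem i) hK hMK).symm
    -- All other factors lie in `K`, so modulo `K` only the `i`-th coordinate survives.
    have hproj : ∀ x : ∀ i, N i, QuotientGroup.mk' K (mulMap N x) = QuotientGroup.mk' K (x i) := by
      intro x
      rw [mulMap, map_list_prod, List.map_ofFn]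
      exact List.prod_ofFn_eq_of_forall_ne _ i fun j hj =>
        (QuotientGroup.eq_one_iff _).2 (hle j hj (x j).2)
    have hxyi : (x i : G)⁻¹ * y i ∈ N i ⊓ K :=
      ⟨(N i).mul_mem ((N i).inv_mem (x i).2) (y i).2,
        QuotientGroup.eq.1 ((hproj x).symm.trans ((congrArg _ hxy).trans (hproj y)))⟩
    rw [minClosedNormal.inf_eq_bot_of_not_le (hmem i) hK.1.1 hK.1.2.1 hMK, Subgroup.mem_bot,
      inv_mul_eq_one] at hxyi
    exact Subtype.ext hxyi
  · have := Subgroup.iSup_normal N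
    refine Dense.mono (iSup_subset_range_mulMap N hn) ?_
    have htop : (⨆ i, N i).topologicalClosure = ⊤ := by
      by_contra hne
      obtain ⟨K, hK, hle⟩ := exists_le_maxClosedNormal hgen hquot
        (Subgroup.is_normal_topologicalClosure _) (Subgroup.isClosed_topologicalClosure _) hne
      obtain ⟨M, hM, hMK⟩ := exists_minClosedNormal_not_le hgen hquot hmax hK
      obtain ⟨i, rfl⟩ := hN.symm ▸ hM
      exact hMK ((le_iSup N i).trans ((Subgroup.le_topologicalClosure _).trans hle))
    rw [dense_iff_closure_eq, ← Subgroup.topologicalClosure_coe, htop, Subgroup.coe_top]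

end

theorem mainTheorem11 (G : Type*) [Group G] [TopologicalSpace G] [IsTopologicalGroup G]
    [T2Space G] [LocallyCompactSpace G] [TotallyDisconnectedSpace G] [Nontrivial G]
    (hgen : IsCompactlyGeneratedGroup G)
    (hcentre : Subgroup.center G = ⊥)
    (hquot : NoNontrivialDiscreteQuotient G)
    (hmax : sInf (maxClosedNormal G) = ⊥) :
    ((minClosedNormal G).Finite ∧ (minClosedNormal G).Nonempty ∧
      (maxClosedNormal G).Finite ∧ (maxClosedNormal G).Nonempty) ∧
    Set.BijOn (fun N : Subgroup G => Subgroup.centralizer (N : Set G))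
      (minClosedNormal G) (maxClosedNormal G) ∧
    (∀ N ∈ minClosedNormal G ∪ maxClosedNormal G, IsQuasiFactor N) ∧
    (∀ (p : ℕ) (N : Fin p → Subgroup G), Function.Injective N →
      Set.range N = minClosedNormal G → IsQuasiProduct N) := by
  have hbij := bijOn_centralizer hgen hcentre hquot hmax
  have hfin := finite_maxClosedNormal hgen hquot hmax
  have hne : (maxClosedNormal G).Nonempty := by
    rw [Set.nonempty_iff_ne_empty]
    intro h
    rw [h, sInf_empty] at hmax
    exact top_ne_bot hmax
  refine ⟨⟨?_, ?_, hfin, hne⟩, hbij, ?_, fun p N hinj hN =>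
    isQuasiProduct_of_range_eq hgen hcentre hquot hmax N hinj hN⟩
  · exact Set.Finite.of_finite_image (hbij.image_eq.symm ▸ hfin) hbij.injOn
  · exact Set.image_nonempty.1 (hbij.image_eq.symm ▸ hne)
  · rintro N (hN | hN)
    · exact minClosedNormal.isQuasiFactor hcentre hmax hN
    · exact maxClosedNormal.isQuasiFactor hgen hquot hmax hN
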